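/- Let $(W,S)$ be a Coxeter system with $S=\{s_1,\dots,s_n\}$ finite and with exponents $m_{ij}$ ($m_{ii}=1$, $m_{ij}=m_{ji}\in\{2,3,\dots\}\cup\{\infty\}$ for $i\ne j$), and suppose that $W$ is odd-angled, i.e. every $m_{ij}$ is odd or infinite. Let $\mathrm{Cox}_{\mathrm{div}}(W)$ be the divisibility diagram of $(W,S)$: its vertices are the elements of $S$, and distinct $s_i,s_j$ are joined (by an edge labelled by the least divisor greater than $1$ of $m_{ij}$) if and only if $m_{ij}<\infty$. Let $C_1,\dots,C_k$ be its connected components, let $S_i\subset S$ be the set of vertices of $C_i$, and let $(W_i,S_i)$ be the Coxeter system with generating set $S_i$ and the exponents of $(W,S)$ restricted to $S_i$. Then $W=W_1*W_2*\dots*W_k$, by the isomorphism that is the identity on the generators; and $W$ contains a proper finite-index reflection subgroup if and only if at least one of $W_1,\dots,W_k$ contains one. Here a reflection of a Coxeter system is a conjugate of a generator, and a proper finite-index reflection subgroup is a subgroup generated by a (possibly empty) set of reflections whose index is finite and greater than $1$. -/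

import Mathlib

/-- A Coxeter matrix is *odd-angled* if all its entries are odd or infinite
(the value `0` encodes `∞`). -/
def CoxeterMatrix.IsOddAngled {B : Type*} (M : CoxeterMatrix B) : Prop :=
  ∀ i j : B, M i j = 0 ∨ Odd (M i j)

/-- The underlying graph of the divisibility diagram: the vertices are the (indices of the)
generating reflections, and two distinct vertices are joined if and only if `m i j` is finite
(the value `0` encodes `∞`). The label of an edge, which is the least non-trivial divisor
`(M i j).minFac`, plays no role for the connected components. -/
def CoxeterMatrix.divGraph {B : Type*} (M : CoxeterMatrix B) : SimpleGraph B where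
  Adj i j := i ≠ j ∧ M i j ≠ 0
  symm := ⟨fun i j h => ⟨h.1.symm, by rw [M.symmetric j i]; exact h.2⟩⟩
  loopless := ⟨fun _ h => h.1 rfl⟩

/-- The Coxeter matrix obtained by keeping only the generators in `s`. -/
def CoxeterMatrix.restrict {B : Type*} (M : CoxeterMatrix B) (s : Set B) : CoxeterMatrix s where
  M := M.M.submatrix Subtype.val Subtype.val
  isSymm := M.isSymm.submatrix _
  diagonal i := M.diagonal i
  off_diagonal i j h := M.off_diagonal i j (fun e => h (Subtype.ext e))

/-- The subgroup `V` is generated by reflections of the Coxeter system, that is, by conjugates of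
the generators (the trivial subgroup is generated by the empty set of reflections). -/
def CoxeterSystem.IsReflectionSubgroup {B W : Type*} [Group W] {M : CoxeterMatrix B}
    (cs : CoxeterSystem M W) (V : Subgroup W) : Prop :=
  ∃ R : Set W, (∀ t ∈ R, cs.IsReflection t) ∧ V = Subgroup.closure R

/-- The group has a subgroup `V` generated by reflections whose index satisfies
`1 < [W : V] < ∞`. -/
def CoxeterSystem.HasProperFiniteIndexReflectionSubgroup {B W : Type*} [Group W]
    {M : CoxeterMatrix B} (cs : CoxeterSystem M W) : Prop :=
  ∃ V : Subgroup W, cs.IsReflectionSubgroup V ∧ V ≠ ⊤ ∧ V.FiniteIndex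

/-!
Generators in different components have infinite exponent, so the Coxeter presentation splits as a
free product. The rest holds in any free product of groups with chosen generators, where
"reflection" means "conjugate of a generator".

If `V` is a reflection subgroup of a factor `G c`, then its preimage under the projection to `G c`
is generated by `V` and the kernel of the projection, which is the normal closure of the generators
of the other factors, hence a reflection subgroup.

Conversely, let `V` be a reflection subgroup of the free product. It contains every factor only if
it is everything, so one has to show that each `V ∩ G c` is a reflection subgroup of `G c`. This
follows from a Kurosh-type retraction `ρ : V → V ∩ G c`, which sends a conjugate of an element of a
factor either to `1` or to a conjugate of itself. To construct `ρ`, one chooses a cocycle of `G c`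
on the cosets of `V` with values in `V ∩ G c`, extends it to the free product by the trivial
cocycle on the other factors, and restricts it to the stabilizer `V` of the base point.
-/

open Monoid CoprodI

section ConjGenerated

variable {G H : Type*} [Group G] [Group H] {S T : Set G} {U V : Subgroup G}

/-- `V` is generated by conjugates of elements of `S`. If `S` is the set of simple reflections of a
Coxeter group, these are the reflection subgroups. -/
def IsConjGenerated (S : Set G) (V : Subgroup G) : Prop :=
  ∃ R ⊆ Group.conjugatesOfSet S, V = Subgroup.closure R

/-- Some subgroup of finite index, other than the whole group, is generated by conjugates of
elements of `S`. -/
def HasProperFiniteIndexConjGenerated (S : Set G) : Prop :=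
  ∃ V : Subgroup G, IsConjGenerated S V ∧ V ≠ ⊤ ∧ V.FiniteIndex

theorem isConjGenerated_normalClosure (S : Set G) :
    IsConjGenerated S (Subgroup.normalClosure S) :=
  ⟨_, subset_rfl, rfl⟩

theorem IsConjGenerated.mono (hV : IsConjGenerated S V) (h : S ⊆ T) : IsConjGenerated T V := by
  obtain ⟨R, hR, rfl⟩ := hV
  exact ⟨R, hR.trans (Group.conjugatesOfSet_mono h), rfl⟩

theorem IsConjGenerated.sup (hU : IsConjGenerated S U) (hV : IsConjGenerated S V) :
    IsConjGenerated S (U ⊔ V) := by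
  obtain ⟨Q, hQ, rfl⟩ := hU
  obtain ⟨R, hR, rfl⟩ := hV
  exact ⟨Q ∪ R, Set.union_subset hQ hR, (Subgroup.closure_union Q R).symm⟩

theorem IsConjGenerated.map (hV : IsConjGenerated S V) (f : G →* H) :
    IsConjGenerated (f '' S) (V.map f) := by
  obtain ⟨R, hR, rfl⟩ := hV
  refine ⟨f '' R, ?_, f.map_closure R⟩
  rintro _ ⟨r, hr, rfl⟩
  obtain ⟨s, hs, hsr⟩ := Group.mem_conjugatesOfSet_iff.1 (hR hr)
  exact Group.mem_conjugatesOfSet_iff.2 ⟨f s, Set.mem_image_of_mem f hs, f.map_isConj hsr⟩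

theorem finiteIndex_comap (f : G →* H) (V : Subgroup H) [V.FiniteIndex] :
    (V.comap f).FiniteIndex :=
  ⟨by
    rw [Subgroup.index_comap]
    exact mt Subgroup.index_eq_zero_of_relIndex_eq_zero Subgroup.FiniteIndex.index_ne_zero⟩

theorem HasProperFiniteIndexConjGenerated.image (h : HasProperFiniteIndexConjGenerated S)
    (e : G ≃* H) : HasProperFiniteIndexConjGenerated (e '' S) := by
  obtain ⟨V, hV, hne, hfin⟩ := h
  refine ⟨V.map (e : G →* H), hV.map (e : G →* H), fun htop => hne ?_, ?_⟩
  · exact Subgroup.map_injective e.injective (htop.trans (Subgroup.map_equiv_top e).symm)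
  · rw [Subgroup.map_equiv_eq_comap_symm]
    exact finiteIndex_comap _ V

theorem hasProperFiniteIndexConjGenerated_image_iff (e : G ≃* H) :
    HasProperFiniteIndexConjGenerated (e '' S) ↔ HasProperFiniteIndexConjGenerated S :=
  ⟨fun h => by simpa [Set.image_image] using h.image e.symm, fun h => h.image e⟩

end ConjGenerated

section Cocycle

variable {H X A : Type*} [Group H] [MulAction H X] [Group A]

/-- An `A`-valued cocycle for an action of `H` on `X`, that is, a functor from the action groupoid
to `A`; as for functors, `α g x` is the value at the arrow from `x` to `g • x`. -/
def IsActionCocycle (α : H → X → A) : Prop :=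
  ∀ g h x, α (g * h) x = α g (h • x) * α h x

namespace IsActionCocycle

variable {α : H → X → A}

theorem apply_one (hα : IsActionCocycle α) (x : X) : α 1 x = 1 := by
  simpa using hα 1 1 x

theorem isConj_apply_conj (hα : IsActionCocycle α) {g : H} {x : X} (hx : g • x = x) (w : H) :
    IsConj (α g x) (α (w * g * w⁻¹) (w • x)) := by
  have hinv : α w x * α w⁻¹ (w • x) = 1 := by
    simpa [hα.apply_one] using (hα w w⁻¹ (w • x)).symm
  refine isConj_iff.2 ⟨α w x, ?_⟩
  rw [hα, hα, inv_smul_smul, hx, eq_inv_of_mul_eq_one_right hinv]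

/-- The restriction of a cocycle to a vertex group of the action groupoid. -/
def stabilizerHom (hα : IsActionCocycle α) (x : X) : MulAction.stabilizer H x →* A where
  toFun v := α v x
  map_one' := hα.apply_one x
  map_mul' u v := by
    rw [Subgroup.coe_mul, hα, MulAction.mem_stabilizer_iff.1 v.2]

end IsActionCocycle

theorem exists_orbit_section (x₀ : X) :
    ∃ σ : X → H, σ x₀ = 1 ∧ ∀ x ∈ MulAction.orbit H x₀, σ x • x₀ = x := by
  classical
  have hsurj (x : X) : ∃ s : H, x ∈ MulAction.orbit H x₀ → s • x₀ = x := by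
    by_cases hx : x ∈ MulAction.orbit H x₀
    · exact hx.imp fun s hs _ => hs
    · exact ⟨1, fun h => absurd h hx⟩
  choose σ hσ using hsurj
  refine ⟨Function.update σ x₀ 1, Function.update_self .., fun x hx => ?_⟩
  obtain rfl | hne := eq_or_ne x x₀
  · rw [Function.update_self, one_smul]
  · rw [Function.update_of_ne hne, hσ x hx]

theorem exists_stabilizer_cocycle (x₀ : X) :
    ∃ α : H → X → MulAction.stabilizer H x₀, IsActionCocycle α ∧
      (∀ a : MulAction.stabilizer H x₀, α a x₀ = a) ∧
      ∀ h x, h • x = x → α h x = 1 ∨ IsConj h (α h x) := by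
  classical
  obtain ⟨σ, hσ₀, hσ⟩ := exists_orbit_section (H := H) x₀
  have hmem (h : H) {x : X} (hx : x ∈ MulAction.orbit H x₀) :
      (σ (h • x))⁻¹ * h * σ x ∈ MulAction.stabilizer H x₀ := by
    rw [MulAction.mem_stabilizer_iff, mul_smul, mul_smul, hσ x hx, inv_smul_eq_iff,
      hσ _ (MulAction.mem_orbit_of_mem_orbit h hx)]
  let α (h : H) (x : X) : MulAction.stabilizer H x₀ :=
    if hx : x ∈ MulAction.orbit H x₀ then ⟨(σ (h • x))⁻¹ * h * σ x, hmem h hx⟩ else 1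
  have hα_orbit (h : H) {x : X} (hx : x ∈ MulAction.orbit H x₀) :
      (α h x : H) = (σ (h • x))⁻¹ * h * σ x := by
    simp only [α, dif_pos hx]
  have hα_off (h : H) {x : X} (hx : x ∉ MulAction.orbit H x₀) : α h x = 1 := dif_neg hx
  refine ⟨α, fun g h x => ?_, fun a => ?_, fun h x hfix => ?_⟩
  · by_cases hx : x ∈ MulAction.orbit H x₀
    · apply Subtype.ext
      rw [Subgroup.coe_mul, hα_orbit _ hx, hα_orbit _ hx,
        hα_orbit _ (MulAction.mem_orbit_of_mem_orbit h hx), mul_smul]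
      group
    · have hx' : h • x ∉ MulAction.orbit H x₀ := fun h' => hx <| by
        rwa [← MulAction.orbit_eq_iff, MulAction.orbit_smul, MulAction.orbit_eq_iff] at h'
      rw [hα_off _ hx, hα_off _ hx, hα_off _ hx', mul_one]
  · apply Subtype.ext
    rw [hα_orbit _ (MulAction.mem_orbit_self x₀), MulAction.mem_stabilizer_iff.1 a.2, hσ₀]
    group
  · by_cases hx : x ∈ MulAction.orbit H x₀
    · refine Or.inr (isConj_iff.2 ⟨(σ x)⁻¹, ?_⟩)
      rw [hα_orbit h hx, hfix, inv_inv]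
    · exact Or.inl (hα_off h hx)

end Cocycle

section FreeProduct

variable {ι : Type*} {G : ι → Type*} [∀ c, Group (G c)]

section Action

variable {X A : Type*} [∀ c, MulAction (G c) X] [MulAction (CoprodI G) X] [Group A]

theorem exists_coprodI_cocycle (hX : ∀ c (g : G c) (x : X), (of g : CoprodI G) • x = g • x)
    {α : ∀ c, G c → X → A} (hα : ∀ c, IsActionCocycle (α c)) :
    ∃ β : CoprodI G → X → A, IsActionCocycle β ∧ ∀ c (g : G c) x, β (of g) x = α c g x := by
  -- A cocycle of a group is the same as a section of its semidirect product with `X → A`.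
  let Φ : CoprodI G →* (X → A) ⋊[mulAutArrow] CoprodI G := CoprodI.lift fun c =>
    { toFun := fun g => ⟨fun x => α c g (g⁻¹ • x), of g⟩
      map_one' := by
        ext <;> simp [(hα c).apply_one]
      map_mul' := fun g h => by
        ext x
        · change α c (g * h) ((g * h)⁻¹ • x) =
            α c g (g⁻¹ • x) * α c h (h⁻¹ • (of g : CoprodI G)⁻¹ • x)
          rw [hα c, ← map_inv, hX, mul_inv_rev, mul_smul, smul_inv_smul]
        · simp }
  have hright (w : CoprodI G) : (Φ w).right = w := by
    have h : SemidirectProduct.rightHom.comp Φ = MonoidHom.id (CoprodI G) := by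
      ext c g
      simp [Φ]
    exact DFunLike.congr_fun h w
  refine ⟨fun w x => (Φ w).left (w • x), fun v w x => ?_, fun c g x => ?_⟩
  · change (Φ (v * w)).left ((v * w) • x) = (Φ v).left (v • w • x) * (Φ w).left (w • x)
    rw [map_mul, SemidirectProduct.mul_left, Pi.mul_apply, hright, mul_smul]
    change _ * (Φ w).left (v⁻¹ • v • w • x) = _
    rw [inv_smul_smul]
  · simp [Φ, hX]

theorem exists_stabilizer_retraction
    (hX : ∀ c (g : G c) (x : X), (of g : CoprodI G) • x = g • x) (x₀ : X) (c : ι) :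
    ∃ ρ : MulAction.stabilizer (CoprodI G) x₀ →* MulAction.stabilizer (G c) x₀,
      (∀ a v, v.1 = of a.1 → ρ v = a) ∧
      ∀ d (g : G d) v, IsConj (of g) v.1 →
        ρ v = 1 ∨ IsConj v.1 (of (ρ v).1) := by
  classical
  obtain ⟨γ, hγ, hγ_self, hγ_conj⟩ := exists_stabilizer_cocycle (H := G c) x₀
  let α : ∀ d, G d → X → MulAction.stabilizer (G c) x₀ := Function.update (fun _ _ _ => 1) c γ
  have hα_self : α c = γ := Function.update_self ..
  have hα_ne {d : ι} (hd : d ≠ c) : α d = fun _ _ => 1 := Function.update_of_ne hd ..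
  have hα (d : ι) : IsActionCocycle (α d) := by
    obtain rfl | hd := eq_or_ne d c
    · rwa [hα_self]
    · simp [hα_ne hd, IsActionCocycle]
  have hα_conj (d : ι) (g : G d) (x : X) (hx : g • x = x) :
      α d g x = 1 ∨ IsConj (of g : CoprodI G) (of (α d g x : G c)) := by
    obtain rfl | hd := eq_or_ne d c
    · rw [hα_self]
      exact (hγ_conj g x hx).imp_right of.map_isConj
    · simp [hα_ne hd]
  obtain ⟨β, hβ, hβ_of⟩ := exists_coprodI_cocycle hX hα
  refine ⟨hβ.stabilizerHom x₀, fun a v hv => ?_, fun d g v hgv => ?_⟩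
  · change β v x₀ = a
    rw [hv, hβ_of, hα_self, hγ_self]
  · obtain ⟨w, hw⟩ := isConj_iff.1 hgv
    have hfix : (of g : CoprodI G) • w⁻¹ • x₀ = w⁻¹ • x₀ := by
      rw [eq_inv_smul_iff, ← mul_smul, ← mul_smul, hw]
      exact v.2
    have hβ_conj : IsConj (α d g (w⁻¹ • x₀)) (hβ.stabilizerHom x₀ v) := by
      simpa [hw, hβ_of] using! hβ.isConj_apply_conj hfix w
    rw [hX] at hfix
    refine (hα_conj d g _ hfix).imp (fun h => ?_) fun h => ?_
    · rwa [h, isConj_one_right] at hβ_conj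
    · exact hgv.symm.trans <| h.trans <|
        (of.comp (MulAction.stabilizer (G c) x₀).subtype).map_isConj hβ_conj

end Action

theorem exists_retraction_comap_of (V : Subgroup (CoprodI G)) (c : ι) :
    ∃ ρ : V →* V.comap (of : G c →* CoprodI G),
      (∀ a v, v.1 = of a.1 → ρ v = a) ∧
      ∀ d (g : G d) v, IsConj (of g) v.1 →
        ρ v = 1 ∨ IsConj v.1 (of (ρ v).1) := by
  let x₀ : CoprodI G ⧸ V := (1 : CoprodI G)
  let _ (d : ι) : MulAction (G d) (CoprodI G ⧸ V) := MulAction.compHom _ (of : G d →* CoprodI G)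
  have hV : MulAction.stabilizer (CoprodI G) x₀ = V := MulAction.stabilizer_quotient V
  have hVc : MulAction.stabilizer (G c) x₀ = V.comap of := by
    ext g
    exact SetLike.ext_iff.1 hV (of g)
  have h := exists_stabilizer_retraction (G := G) (fun _ _ _ => rfl) x₀ c
  rwa [hV, hVc] at h

section Proj

open Classical in
/-- The projection of a free product to a factor that is trivial on the other factors. -/
noncomputable def coprodIProj (c : ι) : CoprodI G →* G c :=
  CoprodI.lift (Pi.mulSingle c (MonoidHom.id (G c)))

theorem coprodIProj_of (c : ι) (g : G c) : coprodIProj c (of g) = g := by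
  classical exact of_leftInverse c g

theorem coprodIProj_of_ne {c d : ι} (h : d ≠ c) (g : G d) : coprodIProj c (of g) = 1 := by
  classical rw [coprodIProj, lift_of, Pi.mulSingle_eq_of_ne h, MonoidHom.one_apply]

theorem ker_coprodIProj {S : ∀ c, Set (G c)} (hS : ∀ c, Subgroup.closure (S c) = ⊤) (c : ι) :
    (coprodIProj c : CoprodI G →* G c).ker =
      Subgroup.normalClosure (⋃ d ≠ c, (of : G d →* CoprodI G) '' S d) := by
  set N := Subgroup.normalClosure (⋃ d ≠ c, (of : G d →* CoprodI G) '' S d) with hN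
  have hof {d : ι} (hd : d ≠ c) (g : G d) : (of g : CoprodI G) ∈ N := by
    have hle : Subgroup.closure (S d) ≤ N.comap of := (Subgroup.closure_le _).2 fun s hs =>
      Subgroup.subset_normalClosure <| Set.mem_biUnion hd (Set.mem_image_of_mem of hs)
    exact hle (hS d ▸ Subgroup.mem_top g)
  have hfactor :
      ((QuotientGroup.mk' N).comp of).comp (coprodIProj c) = QuotientGroup.mk' N := by
    ext d g
    obtain rfl | hd := eq_or_ne d c
    · simp [coprodIProj_of]
    · simpa [coprodIProj_of_ne hd] using ((QuotientGroup.eq_one_iff _).2 (hof hd g)).symm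
  refine le_antisymm (fun w hw => ?_) (Subgroup.normalClosure_le_normal ?_)
  · rw [← QuotientGroup.ker_mk' N, MonoidHom.mem_ker, ← hfactor]
    simp [MonoidHom.mem_ker.1 hw]
  · simp only [Set.iUnion_subset_iff]
    rintro d hd _ ⟨g, -, rfl⟩
    exact coprodIProj_of_ne hd g

end Proj

theorem IsConjGenerated.comap_coprodIProj {S : ∀ c, Set (G c)}
    (hS : ∀ c, Subgroup.closure (S c) = ⊤) {c : ι} {V : Subgroup (G c)}
    (hV : IsConjGenerated (S c) V) :
    IsConjGenerated (⋃ d, (of : G d →* CoprodI G) '' S d) (V.comap (coprodIProj c)) := by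
  have hsection : (coprodIProj c).comp (of : G c →* CoprodI G) = MonoidHom.id (G c) :=
    MonoidHom.ext (coprodIProj_of c)
  have hsup : V.comap (coprodIProj c) = V.map of ⊔ (coprodIProj c).ker := by
    rw [← Subgroup.comap_map_eq, Subgroup.map_map, hsection, Subgroup.map_id]
  rw [hsup, ker_coprodIProj hS]
  exact ((hV.map of).mono (Set.subset_iUnion (fun d => (of : G d →* CoprodI G) '' S d) c)).sup
    ((isConjGenerated_normalClosure _).mono (Set.iUnion_mono fun _ => Set.iUnion_subset fun _ =>
      subset_rfl))

theorem IsConjGenerated.comap_of {S : ∀ c, Set (G c)} {V : Subgroup (CoprodI G)}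
    (hV : IsConjGenerated (⋃ d, (of : G d →* CoprodI G) '' S d) V) (c : ι) :
    IsConjGenerated (S c) (V.comap of) := by
  obtain ⟨ρ, hρ_of, hρ_conj⟩ := exists_retraction_comap_of V c
  let T : Set (G c) := Group.conjugatesOfSet (S c) ∩ V.comap (of : G c →* CoprodI G)
  obtain ⟨R, hR, hVR⟩ := hV
  have hρ_gen (v : V) (hv : (v : CoprodI G) ∈ R) : (ρ v : G c) ∈ Subgroup.closure T := by
    obtain ⟨s, hs, hsv⟩ := Group.mem_conjugatesOfSet_iff.1 (hR hv)
    obtain ⟨d, t, ht, rfl⟩ := Set.mem_iUnion.1 hs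
    obtain hρ | hρ := hρ_conj d t v hsv
    · rw [hρ]
      exact one_mem _
    have hproj : IsConj (coprodIProj c (of t)) (ρ v : G c) := by
      simpa [coprodIProj_of] using (coprodIProj c).map_isConj (hsv.trans hρ)
    obtain rfl | hd := eq_or_ne d c
    · rw [coprodIProj_of] at hproj
      exact Subgroup.subset_closure
        ⟨Group.mem_conjugatesOfSet_iff.2 ⟨t, ht, hproj⟩, (ρ v).2⟩
    · rw [coprodIProj_of_ne hd, isConj_one_right] at hproj
      rw [hproj]
      exact one_mem _
  have hρ_mem : V ≤ ((Subgroup.closure T).comap ((Subgroup.subtype _).comp ρ)).map V.subtype := by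
    conv_lhs => rw [hVR]
    refine (Subgroup.closure_le _).2 fun r hr => ?_
    have hrV : r ∈ V := hVR ▸ Subgroup.subset_closure hr
    exact ⟨⟨r, hrV⟩, hρ_gen _ hr, rfl⟩
  refine ⟨T, Set.inter_subset_left, le_antisymm (fun a ha => ?_)
    ((Subgroup.closure_le _).2 Set.inter_subset_right)⟩
  obtain ⟨v, hv, hva⟩ := hρ_mem ha
  have hρv : ((ρ v : V.comap of) : G c) ∈ Subgroup.closure T := hv
  rwa [hρ_of ⟨a, ha⟩ v hva] at hρv

theorem hasProperFiniteIndexConjGenerated_coprodI_iff {S : ∀ c, Set (G c)}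
    (hS : ∀ c, Subgroup.closure (S c) = ⊤) :
    HasProperFiniteIndexConjGenerated (⋃ c, (of : G c →* CoprodI G) '' S c) ↔
      ∃ c, HasProperFiniteIndexConjGenerated (S c) := by
  constructor
  · rintro ⟨V, hV, hne, hfin⟩
    obtain ⟨c, hc⟩ : ∃ c, V.comap (of : G c →* CoprodI G) ≠ ⊤ := by
      by_contra! htop
      refine hne ((Subgroup.eq_top_iff' V).2 fun w => ?_)
      induction w using CoprodI.induction_on with
      | one => exact one_mem V
      | of c g => exact Subgroup.mem_comap.1 (htop c ▸ Subgroup.mem_top g)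
      | mul w w' hw hw' => exact mul_mem hw hw'
    exact ⟨c, V.comap of, hV.comap_of c, hc, finiteIndex_comap _ V⟩
  · rintro ⟨c, V, hV, hne, hfin⟩
    refine ⟨V.comap (coprodIProj c), hV.comap_coprodIProj hS, fun htop => hne ?_,
      finiteIndex_comap _ V⟩
    have hsurj : Function.Surjective (coprodIProj c : CoprodI G →* G c) := fun g =>
      ⟨of g, coprodIProj_of c g⟩
    exact Subgroup.comap_injective hsurj (htop.trans (Subgroup.comap_top _).symm)

end FreeProduct

section Coxeter

variable {B W : Type*} [Group W] {M : CoxeterMatrix B} (cs : CoxeterSystem M W)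

theorem hasProperFiniteIndexReflectionSubgroup_iff :
    cs.HasProperFiniteIndexReflectionSubgroup ↔
      HasProperFiniteIndexConjGenerated (Set.range cs.simple) := by
  have hrefl (t : W) :
      t ∈ Group.conjugatesOfSet (Set.range cs.simple) ↔ cs.IsReflection t := by
    simp only [Group.mem_conjugatesOfSet_iff, Set.exists_range_iff, isConj_iff,
      CoxeterSystem.IsReflection, eq_comm (a := t)]
    exact exists_comm
  simp only [CoxeterSystem.HasProperFiniteIndexReflectionSubgroup,
    HasProperFiniteIndexConjGenerated, CoxeterSystem.IsReflectionSubgroup, IsConjGenerated,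
    Set.subset_def, hrefl]

/-- The homomorphism from the Coxeter group on the generators in `s` to the whole Coxeter group
that is the identity on these generators. -/
noncomputable def parabolicHom {s : Set B} {P : Type*} [Group P]
    (csP : CoxeterSystem (M.restrict s) P) : P →* W :=
  csP.lift ⟨fun b => cs.simple b, fun i j => cs.simple_mul_simple_pow i j⟩

theorem parabolicHom_simple {s : Set B} {P : Type*} [Group P]
    (csP : CoxeterSystem (M.restrict s) P) (b : s) :
    parabolicHom cs csP (csP.simple b) = cs.simple b :=
  csP.lift_apply_simple _ b

variable {ι : Type*} {p : B → ι} (hp : ∀ i j, M i j ≠ 0 → p i = p j)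
  {G : ι → Type*} [∀ c, Group (G c)] (cs' : ∀ c, CoxeterSystem (M.restrict {b | p b = c}) (G c))

/-- The image of a generator in the free product of the Coxeter groups on the fibers of `p`. -/
noncomputable def coprodSimple (b : B) : CoprodI G :=
  of ((cs' (p b)).simple ⟨b, rfl⟩)

theorem coprodSimple_coe (c : ι) (b : {b | p b = c}) :
    coprodSimple cs' b = of ((cs' c).simple b) := by
  obtain ⟨b, rfl⟩ := b
  rfl

include hp in
theorem isLiftable_coprodSimple : M.IsLiftable (coprodSimple cs') := by
  intro i j
  by_cases hij : M i j = 0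
  · rw [hij, pow_zero]
  let i' : {b | p b = p j} := ⟨i, hp i j hij⟩
  let j' : {b | p b = p j} := ⟨j, rfl⟩
  have hrel : ((cs' (p j)).simple i' * (cs' (p j)).simple j') ^ M i j = 1 :=
    (cs' (p j)).simple_mul_simple_pow i' j'
  rw [coprodSimple_coe cs' (p j) i', coprodSimple_coe cs' (p j) j', ← map_mul, ← map_pow, hrel,
    map_one]

/-- The free product decomposition of a Coxeter group whose generators are partitioned, by the
fibers of `p`, so that generators in different fibers have infinite exponent. -/
noncomputable def coprodEquiv : CoprodI G ≃* W :=
  MonoidHom.toMulEquiv (CoprodI.lift fun c => parabolicHom cs (cs' c))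
    (cs.lift ⟨coprodSimple cs', isLiftable_coprodSimple hp cs'⟩)
    (CoprodI.ext_hom _ _ fun c => (cs' c).ext_simple fun b => by
      simp only [MonoidHom.comp_apply, lift_of, parabolicHom_simple, MonoidHom.id_apply,
        cs.lift_apply_simple, coprodSimple_coe])
    (cs.ext_simple fun b => by
      simp only [MonoidHom.comp_apply, cs.lift_apply_simple, coprodSimple, lift_of,
        parabolicHom_simple, MonoidHom.id_apply])

theorem coprodEquiv_of_simple (c : ι) (b : {b | p b = c}) :
    coprodEquiv cs hp cs' (of ((cs' c).simple b)) = cs.simple b :=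
  (lift_of _ _).trans (parabolicHom_simple cs (cs' c) b)

theorem image_coprodEquiv_simple :
    coprodEquiv cs hp cs' '' (⋃ c, (of : G c →* CoprodI G) '' Set.range (cs' c).simple) =
      Set.range cs.simple := by
  simp only [Set.image_iUnion, ← Set.range_comp, Function.comp_def, coprodEquiv_of_simple]
  ext w
  simp

theorem connectedComponentMk_divGraph_eq {i j : B} (h : M i j ≠ 0) :
    M.divGraph.connectedComponentMk i = M.divGraph.connectedComponentMk j := by
  obtain rfl | hij := eq_or_ne i j
  · rfl
  · exact SimpleGraph.ConnectedComponent.connectedComponentMk_eq_of_adj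
      (show M.divGraph.Adj i j from ⟨hij, h⟩)

end Coxeter

theorem lemma6p3_general {B W ι : Type*} [Group W] {M : CoxeterMatrix B}
    (cs : CoxeterSystem M W) {p : B → ι} (hp : ∀ i j, M i j ≠ 0 → p i = p j)
    {G : ι → Type*} [∀ c, Group (G c)]
    (cs' : ∀ c, CoxeterSystem (M.restrict {b | p b = c}) (G c)) :
    (∃ φ : CoprodI G ≃* W, ∀ (c : ι) (b : {b | p b = c}),
      φ (of ((cs' c).simple b)) = cs.simple b) ∧
    (cs.HasProperFiniteIndexReflectionSubgroup ↔
      ∃ c, (cs' c).HasProperFiniteIndexReflectionSubgroup) := by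
  refine ⟨⟨coprodEquiv cs hp cs', coprodEquiv_of_simple cs hp cs'⟩, ?_⟩
  simp only [hasProperFiniteIndexReflectionSubgroup_iff]
  rw [← image_coprodEquiv_simple cs hp cs', hasProperFiniteIndexConjGenerated_image_iff]
  exact hasProperFiniteIndexConjGenerated_coprodI_iff fun c =>
    (cs' c).subgroup_closure_range_simple

theorem lemma6p3 {B W : Type*} [Finite B] [Group W] {M : CoxeterMatrix B}
    (cs : CoxeterSystem M W) (hodd : M.IsOddAngled)
    {G : M.divGraph.ConnectedComponent → Type*} [∀ c, Group (G c)]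
    (cs' : ∀ c, CoxeterSystem (M.restrict c.supp) (G c)) :
    (∃ φ : Monoid.CoprodI G ≃* W, ∀ (c : M.divGraph.ConnectedComponent) (b : c.supp),
      φ (Monoid.CoprodI.of ((cs' c).simple b)) = cs.simple b) ∧
    (cs.HasProperFiniteIndexReflectionSubgroup ↔
      ∃ c, (cs' c).HasProperFiniteIndexReflectionSubgroup) := by
  exact lemma6p3_general cs (fun _ _ => connectedComponentMk_divGraph_eq) cs'
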